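/- **Setting.** Let $G=(V,E)$ be a finite directed graph. A finite abelian network $\mathcal N$ on $G$ has for each $v\in V$ a finite alphabet $A_v$ and a finite state space $Q_v$; when processor $v$ in state $q$ processes a letter $a\in A_v$, it moves to the state $t_a(q)$ and passes a word $o_a^u(q)\in A_u^*$ to each $u$ with $(v,u)\in E$. The maps $t_a$ ($a \in A_v$) commute, and input words that agree up to permutation produce output words that agree up to permutation. Put $A=\bigsqcup_v A_v$ and $Q=\prod_v Q_v$. A pair $\mathbf x.\mathbf q\in\mathbb Z^A\times Q$ records the letters waiting to be processed and the states; an execution (a word in $A$) is *legal* if each letter is present when it is processed, and *complete* if no positive letter count remains. $\mathcal N$ *halts on all inputs* if $\mathbf x.\mathbf q$ has a complete legal execution for all $\mathbf x\in\mathbb N^A$, $\mathbf q\in Q$; its final state $\mathbf x\triangleright\triangleright\mathbf q$ does not depend on the execution. For a finite commutative monoid $M$ of self-maps of a set $X$, let $e$ be its minimal idempotent (the unique idempotent lying in $Mm$ for every $m\in M$); the elements of $eX$ are called *recurrent*. The monoid is *irreducible* if $X\ne\emptyset$ and for all $x,x'\in X$ there are $m,m'\in M$ with $mx=m'x'$.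 The network is *irreducible* if for every $v$ the monoid $M_v=\langle t_a\rangle_{a\in A_v}$ on $Q_v$ is. A state $\mathbf q\in Q$ is *locally recurrent* if each $\mathbf q_v$ is recurrent for $M_v$, and it is *recurrent* if it is recurrent for the monoid generated by the maps $\mathbf q\mapsto \mathbf 1_a\triangleright\triangleright\mathbf q$, $a\in A$. A *burning element* is a vector $\beta\in\mathbb N^A$ such that for all $\mathbf q\in Q$: $\mathbf q$ is recurrent if and only if $\beta\triangleright\triangleright\mathbf q=\mathbf q$. The *total kernel* is $K=\prod_v K_v\subset\mathbb Z^A$, where $K_v$ is the kernel of the action of $\mathbb Z^{A_v}$ on the recurrent states of $M_v$ (on which each $t_a$ is invertible). Let $\mathbf r_a=\min\{m\ge1: m\mathbf 1_a\in K\}$ and let $D$ be the diagonal matrix with entries $\mathbf r_a$. The *production matrix* $P$ has entries $P_{ba}=\frac1{\mathbf r_a}\#\{$letters $b$ passed when $\mathbf r_a$ letters $a$ are processed from a locally recurrent state$\}$, which does not depend on that state when $\mathcal N$ is irreducible. The *Laplacian* is $L=(I-P)D$. The network is *rectangular* if $K=\prod_{a\in A}\mathbf r_a\mathbb Z$. A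 *burning odometer* is a vector $\mathbf k\in K$ with $\mathbf k\ge\mathbf 1$ and $(I-P)\mathbf k\ge\mathbf 0$; the corresponding burning element is $\beta=(I-P)\mathbf k$. The *sandpilization* of $\mathcal N$, enlarged to allow negative chip counts, acts on chip configurations $\sigma\in\mathbb Z^A$: a letter $a$ with $\sigma_a\ge\mathbf r_a$ may topple, losing $\mathbf r_a$ chips and sending $\mathbf r_aP_{ba}$ chips to each $b\in A$ (so that $\sigma$ becomes $\sigma-L\mathbf 1_a$). A configuration is stable if $\sigma_a<\mathbf r_a$ for all $a$, and $\sigma^\circ$ denotes the stable configuration reached from $\sigma$ by legal topplings. **Corollary 5.6.** Let $\mathcal N$ be a finite irreducible rectangular abelian network that halts on all inputs. Then $\mathcal N$ has a pointwise smallest burning odometer $\mathbf k$, and $\mathbf k=D\mathbf y$ for some $\mathbf y\in\mathbb Z^A$. The configuration $\mathbf r-\mathbf 1-L\mathbf 1$ has a unique stabilization, and the vector $\beta=(I-P)\mathbf k$ corresponding to $\mathbf k$ is a burning element given by $$\beta=L\mathbf y=\mathbf r-\mathbf 1-(\mathbf r-\mathbf 1-L\mathbf 1)^\circ .$$ Moreover,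 $\mathbf 0\le\beta\le\mathbf r$. -/

import Mathlib

section CommutingMaps

variable {I Q : Type*}

/-- The transition monoid of a family of maps `t a : Q → Q`. -/
def transitionMonoid (t : I → Q → Q) : Submonoid (Function.End Q) :=
  Submonoid.closure (Set.range t)

/-- The defining action of the transition monoid is irreducible: the relation
"`m q = m' q'` for some `m, m'`" has exactly one equivalence class. -/
def IsIrreducibleFamily (t : I → Q → Q) : Prop :=
  Nonempty Q ∧ ∀ q q' : Q, ∃ m ∈ transitionMonoid t, ∃ m' ∈ transitionMonoid t, m q = m' q'

/-- `e` is the minimal idempotent of `M`: the idempotent accessible from all of `M`. -/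
def IsMinimalIdempotent (M : Submonoid (Function.End Q)) (e : Function.End Q) : Prop :=
  e ∈ M ∧ e * e = e ∧ ∀ m ∈ M, ∃ m' ∈ M, m' * m = e

/-- The set `eQ` of recurrent states, `e` being the minimal idempotent of the transition monoid. -/
def recurrentStates (t : I → Q → Q) : Set Q :=
  {q | ∃ e, IsMinimalIdempotent (transitionMonoid t) e ∧ ∃ q', e q' = q}

/-- The state reached from `q` after processing the word. -/
def runWord (t : I → Q → Q) : List I → Q → Q
  | [], q => q
  | a :: w, q => runWord t w (t a q)

/-- The output word that results from processing an input word. -/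
def outputWord {B : Type*} (t : I → Q → Q) (o : I → Q → List B) : List I → Q → List B
  | [], _ => []
  | a :: w, q => o a q ++ outputWord t o w (t a q)

end CommutingMaps

/-- An abelian processor with input alphabet `I`, state space `Q` and output alphabets
`B u` indexed by a set `U` of output feeds. -/
structure AbelianProcessor (I Q U : Type*) (B : U → Type*) where
  /-- state transitions -/
  t : I → Q → Q
  /-- message passing functions -/
  o : (u : U) → I → Q → List (B u)
  t_comm : ∀ a b q, t a (t b q) = t b (t a q)
  o_perm : ∀ (w w' : List I), w.Perm w' → ∀ (u : U) (q : Q),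
    (outputWord t (o u) w q).Perm (outputWord t (o u) w' q)

/-- The kernel of the action of `ℤ^I` on the recurrent states of a processor. Each letter acts
invertibly there, so `|w| - |w'|` acts trivially iff `w` and `w'` act in the same way. -/
def AbelianProcessor.kernel {I Q U : Type*} {B : U → Type*} [DecidableEq I]
    (p : AbelianProcessor I Q U B) : Set (I → ℤ) :=
  {k | ∃ w w' : List I, (∀ a, k a = (w.count a : ℤ) - (w'.count a : ℤ)) ∧
    ∀ q ∈ recurrentStates p.t, runWord p.t w q = runWord p.t w' q}

/-- An abelian network on the directed graph `G` with alphabet `Σ v, A v` and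
state space `∀ v, Q v`. -/
structure AbelianNetwork {V : Type*} (G : Digraph V) (A Q : V → Type*) where
  proc : (v : V) → AbelianProcessor (A v) (Q v) {u : V // G.Adj v u} (fun u => A u)

namespace AbelianNetwork

variable {V : Type*} {G : Digraph V} {A Q : V → Type*} (N : AbelianNetwork G A Q)

/-- Every processor is irreducible. -/
def IsIrreducible : Prop := ∀ v, IsIrreducibleFamily (N.proc v).t

def IsLocallyRecurrent (q : ∀ v, Q v) : Prop :=
  ∀ v, q v ∈ recurrentStates (N.proc v).t

variable [DecidableEq V] [∀ v, DecidableEq (A v)]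

/-- The state of the network after processing the letter `a`. -/
def next (a : Σ v, A v) (q : ∀ v, Q v) : ∀ v, Q v :=
  Function.update q a.1 ((N.proc a.1).t a.2 (q a.1))

open Classical in
/-- The number of letters of each type passed when the letter `a` is processed. -/
noncomputable def sent (a : Σ v, A v) (q : ∀ v, Q v) : (Σ v, A v) → ℕ := fun b =>
  if h : G.Adj a.1 b.1 then ((N.proc a.1).o ⟨b.1, h⟩ a.2 (q a.1)).count b.2 else 0

/-- Processing one letter, from the total state `x.q`; the letter counts may become negative. -/
noncomputable def step (c : ((Σ v, A v) → ℤ) × (∀ v, Q v)) (a : Σ v, A v) :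
    ((Σ v, A v) → ℤ) × (∀ v, Q v) :=
  (fun b => c.1 b - (if b = a then 1 else 0) + (N.sent a c.2 b : ℤ), N.next a c.2)

/-- The result `π_w(x.q)` of executing the word `w`. -/
noncomputable def exec (w : List (Σ v, A v)) (c : ((Σ v, A v) → ℤ) × (∀ v, Q v)) :
    ((Σ v, A v) → ℤ) × (∀ v, Q v) :=
  w.foldl N.step c

/-- The execution `w` only processes letters that are present. -/
def IsLegal : List (Σ v, A v) → ((Σ v, A v) → ℤ) × (∀ v, Q v) → Prop
  | [], _ => True
  | a :: w, c => 1 ≤ c.1 a ∧ IsLegal w (N.step c a)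

/-- The execution `w` removes all letters from the network. -/
def IsComplete (w : List (Σ v, A v)) (c : ((Σ v, A v) → ℤ) × (∀ v, Q v)) : Prop :=
  ∀ a, (N.exec w c).1 a ≤ 0

/-- The network halts on the input `x.q`. -/
def HaltsOn (x : (Σ v, A v) → ℤ) (q : ∀ v, Q v) : Prop :=
  ∃ w, N.IsLegal w (x, q) ∧ N.IsComplete w (x, q)

def HaltsOnAllInputs : Prop :=
  ∀ (x : (Σ v, A v) → ℤ) (q : ∀ v, Q v), 0 ≤ x → N.HaltsOn x q

open Classical in
/-- The global action `x ▷▷ q`: the final state after a complete legal execution of `x.q`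
(the final state does not depend on which one). -/
noncomputable def globalAct (x : (Σ v, A v) → ℤ) (q : ∀ v, Q v) : ∀ v, Q v :=
  if h : N.HaltsOn x q then (N.exec h.choose (x, q)).2 else q

/-- `Rec N`, the recurrent states of the action of the global monoid, which is generated by
the maps `τ_a(q) = 1_a ▷▷ q`. -/
noncomputable def recStates : Set (∀ v, Q v) :=
  recurrentStates fun (a : Σ v, A v) (q : ∀ v, Q v) => N.globalAct (Pi.single a 1) q

/-- A burning element: a vector `β ∈ ℕ^A` such that `q` is recurrent iff `β ▷▷ q = q`. -/
def IsBurningElement (β : (Σ v, A v) → ℤ) : Prop :=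
  0 ≤ β ∧ ∀ q : ∀ v, Q v, q ∈ N.recStates ↔ N.globalAct β q = q

/-- The total kernel `K = ∏ K_v`. -/
def totalKernel : Set ((Σ v, A v) → ℤ) :=
  {k | ∀ v, (fun a : A v => k ⟨v, a⟩) ∈ (N.proc v).kernel}

/-- The reset number `r_a`, the least `m ≥ 1` such that `m 1_a ∈ K`. -/
noncomputable def resetNumber (a : Σ v, A v) : ℕ :=
  sInf {m : ℕ | 1 ≤ m ∧ Pi.single a (m : ℤ) ∈ N.totalKernel}

/-- `K = ∏_a r_a ℤ`. -/
def IsRectangular : Prop :=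
  N.totalKernel = {k | ∀ a, (N.resetNumber a : ℤ) ∣ k a}

/-- The number of letters of each type passed in total when the word is processed from `q`. -/
noncomputable def sentByWord : List (Σ v, A v) → (∀ v, Q v) → (Σ v, A v) → ℕ
  | [], _ => 0
  | a :: w, q => N.sent a q + sentByWord w (N.next a q)

open Classical in
/-- `P(r_a 1_a)_b`: the number of letters `b` passed when `r_a` letters `a` are processed, starting
from a locally recurrent state (for an irreducible network, it does not matter which one). -/
noncomputable def resetProduction (a b : Σ v, A v) : ℕ :=
  if h : ∃ q, N.IsLocallyRecurrent q then
    N.sentByWord (List.replicate (N.resetNumber a) a) h.choose b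
  else 0

/-- The production matrix, `P_{ba} = P(r_a 1_a)_b / r_a`. -/
noncomputable def productionMatrix : Matrix (Σ v, A v) (Σ v, A v) ℚ :=
  Matrix.of fun b a => (N.resetProduction a b : ℚ) / (N.resetNumber a : ℚ)

/-- The diagonal matrix `D` of reset numbers. -/
noncomputable def resetMatrix : Matrix (Σ v, A v) (Σ v, A v) ℚ :=
  Matrix.diagonal fun a => (N.resetNumber a : ℚ)

variable [Fintype V] [∀ v, Fintype (A v)]

/-- The Laplacian `L = (I - P) D`. -/
noncomputable def laplacian : Matrix (Σ v, A v) (Σ v, A v) ℚ :=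
  (1 - N.productionMatrix) * N.resetMatrix

/-- The vector `(I - P) k`; for a burning odometer `k` it is the corresponding burning element. -/
noncomputable def correspondingElement (k : (Σ v, A v) → ℤ) : (Σ v, A v) → ℚ :=
  (1 - N.productionMatrix).mulVec fun a => (k a : ℚ)

/-- Burning odometers: the vectors `k` with `(I - P) k ≥ 0`, `k ≥ 1` and `k ∈ K`. -/
def burningOdometers : Set ((Σ v, A v) → ℤ) :=
  {k | 0 ≤ N.correspondingElement k ∧ 1 ≤ k ∧ k ∈ N.totalKernel}

end AbelianNetwork

/-- A toppling network: one unary processor for each letter `a`, which collects `a`'s (chips) and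
topples at its threshold, passing `send a b` letters `b` to the processor of `b`. -/
structure TopplingNetwork (A : Type*) where
  threshold : A → ℕ
  send : A → A → ℕ

namespace TopplingNetwork

variable {A : Type*} (S : TopplingNetwork A)

/-- One legal toppling of a chip configuration; negative chip counts are allowed. -/
def Topples [DecidableEq A] (σ σ' : A → ℤ) : Prop :=
  ∃ a, (S.threshold a : ℤ) ≤ σ a ∧
    σ' = fun b => σ b - (if b = a then (S.threshold a : ℤ) else 0) + (S.send a b : ℤ)

def IsStable (σ : A → ℤ) : Prop := ∀ a, σ a < (S.threshold a : ℤ)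

/-- `σ'` is a stable configuration reached from `σ` by legal topplings. -/
def IsStabilization [DecidableEq A] (σ σ' : A → ℤ) : Prop :=
  Relation.ReflTransGen S.Topples σ σ' ∧ S.IsStable σ'

end TopplingNetwork

/-- The sandpilization: the processor of `a` has states `0, …, r_a - 1`, and passes
`r_a P_{ba} = P(r_a 1_a)_b` letters `b` when it goes from state `r_a - 1` to state `0`. -/
noncomputable def AbelianNetwork.sandpilization {V : Type*} {G : Digraph V} {A Q : V → Type*}
    [DecidableEq V] [∀ v, DecidableEq (A v)] (N : AbelianNetwork G A Q) :
    TopplingNetwork (Σ v, A v) where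
  threshold := N.resetNumber
  send := N.resetProduction

/-!
Processing `r_a` letters `a` from a locally recurrent state acts like one toppling of the
sandpilization, so every execution acts, up to a bounded error, like the toppling vector
`⌊|w| / r⌋`. Halting on large inputs therefore yields vectors `y ≥ 1` with `L y` as large as
desired, and `L u ≥ 0` implies `u ≥ 0`.

For `y ≥ 1`, the condition `L y ≥ 0` says that toppling `y - 1` times, legally or not, stabilizes
`r - 1 - L 1`. By the least action principle, the smallest such `y` comes from the legal
stabilization, and it satisfies `L y = r - 1 - (r - 1 - L 1)°`.

Let `β = L y`. If `q` is recurrent, then executing `r y` letters from `(β + r y).q` gives back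
`(r y).q`, and `r y` acts injectively on recurrent states, so `β ▷▷ q = q`. Conversely, if
`β ▷▷ q = q`, choose `x` sending every state to a recurrent one. For large `n`, executing
`(n β - x).q` processes every letter, hence ends at some `0.q'`, and `q = n β ▷▷ q = x ▷▷ q'` is
recurrent.
-/

section Monoid

theorem exists_pow_isIdempotentElem {M : Type*} [Monoid M] [Finite M] (f : M) :
    ∃ n ≠ 0, IsIdempotentElem (f ^ n) := by
  let _ : TopologicalSpace M := ⊥
  have : DiscreteTopology M := ⟨rfl⟩
  obtain ⟨_, ⟨n, rfl⟩, hn⟩ := exists_idempotent_in_compact_subsemigroup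
    (fun _ => continuous_of_discreteTopology) (Set.range fun n => f ^ (n + 1))
    (Set.range_nonempty _) (Set.toFinite _).isCompact (by
      rintro _ ⟨i, rfl⟩ _ ⟨j, rfl⟩
      exact ⟨i + 1 + j, pow_add f (i + 1) (j + 1)⟩)
  exact ⟨n + 1, n.succ_ne_zero, hn⟩

theorem exists_isIdempotentElem_forall_dvd (M : Type*) [CommMonoid M] [Finite M] :
    ∃ e : M, IsIdempotentElem e ∧ ∀ m, m ∣ e := by
  have := Fintype.ofFinite M
  obtain ⟨n, hn, he⟩ := exists_pow_isIdempotentElem (∏ m : M, m)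
  exact ⟨_, he, fun m =>
    (Finset.dvd_prod_of_mem (fun m : M => m) (Finset.mem_univ m)).trans (dvd_pow_self _ hn)⟩

end Monoid

section Words

variable {I : Type*} [DecidableEq I]

/-- The vector `|w| ∈ ℤ^I` counting how often each letter occurs in the word `w`. -/
def letterCount (w : List I) : I → ℤ := fun a => w.count a

theorem letterCount_nonneg (w : List I) : 0 ≤ letterCount w := fun _ => Int.natCast_nonneg _

theorem letterCount_nil : letterCount ([] : List I) = 0 := rfl

theorem letterCount_append (w w' : List I) :
    letterCount (w ++ w') = letterCount w + letterCount w' := by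
  funext a
  simp [letterCount]

theorem letterCount_replicate (n : ℕ) (a : I) :
    letterCount (List.replicate n a) = Pi.single a (n : ℤ) := by
  funext b
  rcases eq_or_ne b a with rfl | h
  · simp [letterCount]
  · simp [letterCount, List.count_replicate, h, h.symm]

theorem letterCount_cons (a : I) (w : List I) :
    letterCount (a :: w) = Pi.single a 1 + letterCount w :=
  (letterCount_append [a] w).trans (congrArg (· + letterCount w) (letterCount_replicate 1 a))

theorem letterCount_eq_iff_perm {w w' : List I} : letterCount w = letterCount w' ↔ w.Perm w' := by
  simp only [List.perm_iff_count, funext_iff, letterCount, Nat.cast_inj]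

theorem letterCount_flatMap_replicate (n : I → ℕ) (l : List I) :
    letterCount (l.flatMap fun a => List.replicate (n a) a) = fun a => n a * letterCount l a := by
  induction l with
  | nil => simp [letterCount_nil, ← Pi.zero_def]
  | cons a l ih =>
    rw [List.flatMap_cons, letterCount_append, ih, letterCount_replicate, letterCount_cons]
    funext b
    rcases eq_or_ne b a with rfl | h
    · simp [mul_add]
    · simp [h]

theorem exists_letterCount_eq [Finite I] {x : I → ℤ} (hx : 0 ≤ x) :
    ∃ w, letterCount w = x := by
  let m : Multiset I := (Finsupp.equivFunOnFinite.symm fun a => (x a).toNat).toMultiset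
  refine ⟨m.toList, funext fun a => ?_⟩
  rw [letterCount, ← Multiset.coe_count, Multiset.coe_toList, Finsupp.count_toMultiset]
  exact Int.toNat_of_nonneg (hx a)

theorem exists_perm_append_of_forall_pos [Finite I] {n : I → ℤ} (hn : ∀ a, 0 < n a)
    (w : List I) : ∃ l d, w.Perm (l ++ d) ∧
      letterCount l = (fun a => n a * (letterCount w a / n a)) ∧ ∀ a, letterCount d a < n a := by
  obtain ⟨l, hl⟩ := exists_letterCount_eq (x := fun a => n a * (letterCount w a / n a))
    fun a => mul_nonneg (hn a).le (Int.ediv_nonneg (letterCount_nonneg w a) (hn a).le)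
  obtain ⟨d, hd⟩ := exists_letterCount_eq (x := fun a => letterCount w a % n a)
    fun a => Int.emod_nonneg _ (hn a).ne'
  refine ⟨l, d, ?_, hl, fun a => hd ▸ Int.emod_lt_of_pos _ (hn a)⟩
  rw [← letterCount_eq_iff_perm, letterCount_append, hl, hd]
  exact funext fun a => (Int.mul_ediv_add_emod _ _).symm

end Words

section CommutingMaps

variable {I Q : Type*} {t : I → Q → Q}

theorem runWord_append (w w' : List I) (q : Q) :
    runWord t (w ++ w') q = runWord t w' (runWord t w q) := by
  induction w generalizing q with
  | nil => rfl
  | cons _ _ ih => exact ih _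

theorem runWord_replicate (n : ℕ) (a : I) :
    runWord t (List.replicate n a) = (show Function.End Q from t a) ^ n := by
  induction n with
  | zero => rfl
  | succ n ih =>
    funext q
    rw [List.replicate_succ, runWord, ih, pow_succ]
    rfl

theorem mem_transitionMonoid_iff {m : Function.End Q} :
    m ∈ transitionMonoid t ↔ ∃ w, runWord t w = m := by
  constructor
  · intro h
    induction h using Submonoid.closure_induction with
    | mem m h =>
      obtain ⟨a, rfl⟩ := h
      exact ⟨[a], rfl⟩
    | one => exact ⟨[], rfl⟩
    | mul m m' _ _ hm hm' =>
      obtain ⟨w, rfl⟩ := hm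
      obtain ⟨w', rfl⟩ := hm'
      exact ⟨w' ++ w, funext (runWord_append w' w)⟩
  · rintro ⟨w, rfl⟩
    induction w with
    | nil => exact one_mem _
    | cons a w ih => exact mul_mem ih (Submonoid.subset_closure ⟨a, rfl⟩)

theorem commute_runWord (ht : ∀ a b, Function.Commute (t a) (t b)) (w w' : List I) :
    Function.Commute (runWord t w) (runWord t w') := by
  have commute_letter (a : I) : Function.Commute (t a) (runWord t w') := by
    induction w' with
    | nil => exact .id_right
    | cons b w' ih => exact ih.comp_right (ht a b)
  induction w with
  | nil => exact .id_left
  | cons a w ih => exact ih.comp_left (commute_letter a)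

theorem runWord_perm (ht : ∀ a b, Function.Commute (t a) (t b)) {w w' : List I}
    (h : w.Perm w') : runWord t w = runWord t w' := by
  induction h with
  | nil => rfl
  | cons a _ ih => exact congrArg (· ∘ t a) ih
  | swap a b w => exact congrArg (runWord t w ∘ ·) (ht a b).comp_eq
  | trans _ _ ih₁ ih₂ => exact ih₁.trans ih₂

open scoped IsMulCommutative in
theorem exists_isMinimalIdempotent [Finite Q] (ht : ∀ a b, Function.Commute (t a) (t b)) :
    ∃ w, IsMinimalIdempotent (transitionMonoid t) (runWord t w) := by
  have : Finite (Function.End Q) := inferInstanceAs (Finite (Q → Q))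
  have : IsMulCommutative (transitionMonoid t) := by
    refine Submonoid.isMulCommutative_closure (M := Function.End Q) ?_
    rintro _ ⟨a, rfl⟩ _ ⟨b, rfl⟩
    exact (ht a b).comp_eq
  obtain ⟨⟨e, he⟩, hidem, hdvd⟩ := exists_isIdempotentElem_forall_dvd (transitionMonoid t)
  obtain ⟨w, rfl⟩ := mem_transitionMonoid_iff.1 he
  refine ⟨w, he, congrArg Subtype.val hidem, fun m hm => ?_⟩
  obtain ⟨c, hc⟩ := hdvd ⟨m, hm⟩
  exact ⟨c, c.2, congrArg Subtype.val ((mul_comm c ⟨m, hm⟩).trans hc.symm)⟩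

theorem IsMinimalIdempotent.mem_recurrentStates_iff (ht : ∀ a b, Function.Commute (t a) (t b))
    {w : List I} (hw : IsMinimalIdempotent (transitionMonoid t) (runWord t w)) {q : Q} :
    q ∈ recurrentStates t ↔ runWord t w q = q := by
  refine ⟨?_, fun h => ⟨_, hw, q, h⟩⟩
  rintro ⟨e, he, q, rfl⟩
  obtain ⟨m, hm, rfl⟩ := he.2.2 _ hw.1
  obtain ⟨u, rfl⟩ := mem_transitionMonoid_iff.1 hm
  exact (commute_runWord ht w u _).trans (congrArg (runWord t u) (congrFun hw.2.1 q))

theorem exists_forall_runWord_mem_recurrentStates [Finite Q]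
    (ht : ∀ a b, Function.Commute (t a) (t b)) : ∃ w, ∀ q, runWord t w q ∈ recurrentStates t := by
  obtain ⟨w, hw⟩ := exists_isMinimalIdempotent ht
  exact ⟨w, fun q => ⟨_, hw, q, rfl⟩⟩

theorem mapsTo_runWord_recurrentStates (ht : ∀ a b, Function.Commute (t a) (t b)) (w : List I) :
    Set.MapsTo (runWord t w) (recurrentStates t) (recurrentStates t) := by
  rintro _ ⟨e, he, q, rfl⟩
  obtain ⟨u, rfl⟩ := mem_transitionMonoid_iff.1 he.1
  exact ⟨_, he, runWord t w q, commute_runWord ht u w q⟩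

theorem exists_leftInvOn_runWord [Finite Q] (ht : ∀ a b, Function.Commute (t a) (t b))
    (w : List I) : ∃ w', Set.LeftInvOn (runWord t w') (runWord t w) (recurrentStates t) := by
  obtain ⟨u, hu⟩ := exists_isMinimalIdempotent ht
  obtain ⟨m, hm, hmw⟩ := hu.2.2 _ (mem_transitionMonoid_iff.2 ⟨w, rfl⟩)
  obtain ⟨w', rfl⟩ := mem_transitionMonoid_iff.1 hm
  exact ⟨w', fun q hq => (congrFun hmw q).trans ((hu.mem_recurrentStates_iff ht).1 hq)⟩

theorem injOn_runWord_recurrentStates [Finite Q] (ht : ∀ a b, Function.Commute (t a) (t b))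
    (w : List I) : Set.InjOn (runWord t w) (recurrentStates t) :=
  (exists_leftInvOn_runWord ht w).elim fun _ h => h.injOn

theorem surjOn_runWord_recurrentStates [Finite Q] (ht : ∀ a b, Function.Commute (t a) (t b))
    (w : List I) : Set.SurjOn (runWord t w) (recurrentStates t) (recurrentStates t) := by
  obtain ⟨w', hw'⟩ := exists_leftInvOn_runWord ht w
  exact fun q hq => ⟨runWord t w' q, mapsTo_runWord_recurrentStates ht w' hq,
    (commute_runWord ht w w' q).trans (hw' hq)⟩

theorem IsIrreducibleFamily.exists_runWord_eq [Finite Q]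
    (ht : ∀ a b, Function.Commute (t a) (t b)) (hirr : IsIrreducibleFamily t) (q : Q) {q' : Q}
    (hq' : q' ∈ recurrentStates t) : ∃ w, runWord t w q = q' := by
  obtain ⟨m, hm, m', hm', h⟩ := hirr.2 q q'
  obtain ⟨w, rfl⟩ := mem_transitionMonoid_iff.1 hm
  obtain ⟨w', rfl⟩ := mem_transitionMonoid_iff.1 hm'
  obtain ⟨u, hu⟩ := exists_leftInvOn_runWord ht w'
  exact ⟨w ++ u, by rw [runWord_append, h, hu hq']⟩

theorem exists_eqOn_runWord_replicate_id [Finite Q] (ht : ∀ a b, Function.Commute (t a) (t b))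
    (a : I) :
    ∃ n, 1 ≤ n ∧ Set.EqOn (runWord t (List.replicate n a)) id (recurrentStates t) := by
  have : Finite (Function.End Q) := inferInstanceAs (Finite (Q → Q))
  obtain ⟨n, hn, hidem⟩ := exists_pow_isIdempotentElem (show Function.End Q from t a)
  rw [← runWord_replicate] at hidem
  exact ⟨n, Nat.one_le_iff_ne_zero.2 hn, fun q hq => injOn_runWord_recurrentStates ht _
    (mapsTo_runWord_recurrentStates ht _ hq) hq (congrFun hidem q)⟩

end CommutingMaps

namespace AbelianProcessor

variable {I Q U : Type*} {B : U → Type*} [DecidableEq I] (p : AbelianProcessor I Q U B)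

theorem mem_kernel_iff {k : I → ℤ} : k ∈ p.kernel ↔
    ∃ w w', k = letterCount w - letterCount w' ∧
      Set.EqOn (runWord p.t w) (runWord p.t w') (recurrentStates p.t) :=
  exists₂_congr fun _ _ => and_congr_left fun _ => funext_iff.symm

theorem zero_mem_kernel : 0 ∈ p.kernel :=
  p.mem_kernel_iff.2 ⟨[], [], (sub_self _).symm, Set.eqOn_refl _ _⟩

theorem single_mem_kernel_iff [Finite Q] (a : I) (n : ℕ) : Pi.single a (n : ℤ) ∈ p.kernel ↔
    Set.EqOn (runWord p.t (List.replicate n a)) id (recurrentStates p.t) := by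
  rw [mem_kernel_iff, ← letterCount_replicate]
  constructor
  · rintro ⟨w, w', hcount, h⟩ q hq
    have hperm : w.Perm (List.replicate n a ++ w') := by
      rw [← letterCount_eq_iff_perm, letterCount_append, hcount, sub_add_cancel]
    refine injOn_runWord_recurrentStates p.t_comm w'
      (mapsTo_runWord_recurrentStates p.t_comm _ hq) hq ?_
    rw [← runWord_append, ← runWord_perm p.t_comm hperm, h hq, id]
  · exact fun h => ⟨List.replicate n a, [], (sub_zero _).symm, h⟩

end AbelianProcessor

namespace TopplingNetwork

open Matrix Relation

variable {A : Type*} [DecidableEq A] (S : TopplingNetwork A)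

/-- The Laplacian `L` of a toppling network, over `ℤ`: toppling `a` turns `σ` into `σ - L 1_a`. -/
def laplacian : Matrix A A ℤ :=
  diagonal (fun a => (S.threshold a : ℤ)) - of fun b a => (S.send a b : ℤ)

theorem le_of_reflTransGen_topples {S : TopplingNetwork A} {σ τ : A → ℤ} {c : ℤ} (hc : c ≤ 0)
    (hσ : ∀ a, c ≤ σ a) (h : ReflTransGen S.Topples σ τ) (a : A) : c ≤ τ a := by
  induction h with
  | refl => exact hσ a
  | tail _ h ih =>
    obtain ⟨b, hb, rfl⟩ := h
    dsimp only
    split_ifs with hab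
    · subst hab
      lia
    · lia

variable [Fintype A]

theorem laplacian_mulVec_apply (z : A → ℤ) (b : A) :
    (S.laplacian *ᵥ z) b = S.threshold b * z b - ∑ a, S.send a b * z a := by
  rw [laplacian, sub_mulVec, Pi.sub_apply, mulVec_diagonal]
  rfl

theorem topples_iff {σ σ' : A → ℤ} : S.Topples σ σ' ↔
    ∃ a, (S.threshold a : ℤ) ≤ σ a ∧ σ' = σ - S.laplacian *ᵥ Pi.single a 1 := by
  refine exists_congr fun a => and_congr_right fun _ => ?_
  suffices (fun b => σ b - (if b = a then (S.threshold a : ℤ) else 0) + S.send a b) =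
    σ - S.laplacian *ᵥ Pi.single a 1 by rw [this]
  funext b
  rw [Pi.sub_apply, laplacian_mulVec_apply]
  rcases eq_or_ne b a with rfl | h
  · simp only [if_true, Pi.single_apply, mul_ite, mul_one, mul_zero, Finset.sum_ite_eq',
      Finset.mem_univ]
    ring
  · simp [Pi.single_apply, h]

theorem laplacian_mulVec_apply_le {z z' : A → ℤ} (h : z ≤ z') {a : A} (ha : z a = z' a) :
    (S.laplacian *ᵥ z') a ≤ (S.laplacian *ᵥ z) a := by
  rw [laplacian_mulVec_apply, laplacian_mulVec_apply, ha]
  gcongr with b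
  exact h b

theorem nonneg_of_laplacian_mulVec_nonneg {y u : A → ℤ} (hy : 1 ≤ y)
    (hLy : 1 ≤ S.laplacian *ᵥ y) (hLu : 0 ≤ S.laplacian *ᵥ u) : 0 ≤ u := by
  by_contra hu
  obtain ⟨b, hb⟩ : ∃ b, u b < 0 := by simpa [Pi.le_def] using hu
  have hy_pos (c : A) : 0 < y c := hy c
  have : Nonempty A := ⟨b⟩
  obtain ⟨a, ha⟩ := Finite.exists_min fun c => (u c : ℚ) / y c
  have hmin (c : A) : u a * y c ≤ u c * y a := by
    exact_mod_cast (div_le_div_iff₀ (by exact_mod_cast hy_pos a) (by exact_mod_cast hy_pos c)).1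
      (ha c)
  have hua : u a < 0 := by nlinarith [hmin b, hy_pos a, hy_pos b]
  have hle : (S.laplacian *ᵥ (y a • u - u a • y)) a ≤ (S.laplacian *ᵥ 0) a :=
    S.laplacian_mulVec_apply_le
      (fun c => by simpa [mul_comm] using hmin c) (by simp [mul_comm])
  have heq : (S.laplacian *ᵥ (y a • u - u a • y)) a =
      y a * (S.laplacian *ᵥ u) a - u a * (S.laplacian *ᵥ y) a := by
    rw [mulVec_sub, mulVec_smul, mulVec_smul]
    rfl
  rw [heq, mulVec_zero, Pi.zero_apply] at hle
  have hLya : 1 ≤ (S.laplacian *ᵥ y) a := hLy a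
  nlinarith [mul_nonneg (hy_pos a).le (hLu a)]

/-- The toppling vectors, legal or not, that take `σ` to a stable configuration. -/
def stabilizingScripts (σ : A → ℤ) : Set (A → ℤ) :=
  {z | 0 ≤ z ∧ S.IsStable (σ - S.laplacian *ᵥ z)}

variable {S} {σ : A → ℤ}

theorem add_single_mem_stabilizingScripts_iff {z : A → ℤ} {a : A}
    (ha : (S.threshold a : ℤ) ≤ σ a) : z + Pi.single a 1 ∈ S.stabilizingScripts σ ↔
      z ∈ S.stabilizingScripts (σ - S.laplacian *ᵥ Pi.single a 1) := by
  have hconfig : σ - S.laplacian *ᵥ (z + Pi.single a 1) =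
      σ - S.laplacian *ᵥ Pi.single a 1 - S.laplacian *ᵥ z := by
    rw [mulVec_add, sub_sub, add_comm]
  constructor
  · rintro ⟨hz, hstable⟩
    refine ⟨fun b => ?_, hconfig ▸ hstable⟩
    rcases eq_or_ne b a with rfl | hba
    · by_contra hneg
      have hb : (0 : A → ℤ) b = (z + Pi.single b 1 : A → ℤ) b := by
        have := hz b
        simp only [Pi.zero_apply, Pi.add_apply, Pi.single_eq_same] at this hneg ⊢
        lia
      have hle := S.laplacian_mulVec_apply_le hz hb
      have hlt := hstable b
      simp only [mulVec_zero, Pi.zero_apply, Pi.sub_apply] at hle hlt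
      lia
    · simpa [hba] using hz b
  · rintro ⟨hz, hstable⟩
    exact ⟨add_nonneg hz (Pi.single_nonneg.2 zero_le_one), hconfig ▸ hstable⟩

theorem one_le_of_mem_stabilizingScripts {z : A → ℤ} {a : A} (ha : (S.threshold a : ℤ) ≤ σ a)
    (hz : z ∈ S.stabilizingScripts σ) : 1 ≤ z a := by
  rw [← sub_add_cancel z (Pi.single a 1), add_single_mem_stabilizingScripts_iff ha] at hz
  simpa using hz.1 a

/-- The least action principle. -/
theorem IsStabilization.exists_isLeast {τ : A → ℤ} (h : S.IsStabilization σ τ) :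
    ∃ z, IsLeast (S.stabilizingScripts σ) z ∧ τ = σ - S.laplacian *ᵥ z := by
  obtain ⟨hσ, hτ⟩ := h
  induction hσ using ReflTransGen.head_induction_on with
  | refl => exact ⟨0, ⟨⟨le_rfl, by simpa using hτ⟩, fun z hz => hz.1⟩, by simp⟩
  | @head σ _ h _ ih =>
    obtain ⟨a, ha, rfl⟩ := S.topples_iff.1 h
    obtain ⟨z, hz, rfl⟩ := ih
    refine ⟨z + Pi.single a 1, ⟨(add_single_mem_stabilizingScripts_iff ha).2 hz.1, ?_⟩, ?_⟩
    · intro z' hz'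
      rw [← le_sub_iff_add_le]
      refine hz.2 ((add_single_mem_stabilizingScripts_iff ha).1 ?_)
      rwa [sub_add_cancel]
    · rw [mulVec_add, sub_sub, add_comm]

omit [Fintype A] in
theorem IsStabilization.unique [Finite A] {τ τ' : A → ℤ} (h : S.IsStabilization σ τ)
    (h' : S.IsStabilization σ τ') : τ' = τ := by
  have := Fintype.ofFinite A
  obtain ⟨z, hz, rfl⟩ := h.exists_isLeast
  obtain ⟨z', hz', rfl⟩ := h'.exists_isLeast
  rw [hz.unique hz']

theorem exists_isStabilization (h : (S.stabilizingScripts σ).Nonempty) :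
    ∃ τ, S.IsStabilization σ τ := by
  obtain ⟨z, hz⟩ := h
  induction hn : (∑ a, z a).toNat using Nat.strong_induction_on generalizing σ z with
  | _ n ih =>
    by_cases hσ : S.IsStable σ
    · exact ⟨σ, .refl, hσ⟩
    obtain ⟨a, ha⟩ : ∃ a, (S.threshold a : ℤ) ≤ σ a := by simpa [IsStable] using hσ
    have hpos : 1 ≤ ∑ b, z b := (one_le_of_mem_stabilizingScripts ha hz).trans
      (Finset.single_le_sum (fun b _ => hz.1 b) (Finset.mem_univ a))
    have hsum : ∑ b, (z - Pi.single a 1 : A → ℤ) b = ∑ b, z b - 1 := by simp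
    obtain ⟨τ, hreach, hτ⟩ := ih _ (by lia) (z - Pi.single a 1)
      ((add_single_mem_stabilizingScripts_iff ha).1 (by rwa [sub_add_cancel])) rfl
    exact ⟨τ, .head (S.topples_iff.2 ⟨a, ha, rfl⟩) hreach, hτ⟩

variable (S)

/-- The vectors `y ≥ 1` with `L y ≥ 0`; a rectangular network has burning odometers `D y`. -/
def burningScripts : Set (A → ℤ) := {y | 1 ≤ y ∧ 0 ≤ S.laplacian *ᵥ y}

theorem sub_one_mem_stabilizingScripts_iff {y : A → ℤ} :
    y - 1 ∈ S.stabilizingScripts (fun a => S.threshold a - 1 - (S.laplacian *ᵥ 1) a) ↔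
      y ∈ S.burningScripts := by
  refine and_congr sub_nonneg (forall_congr' fun a => ?_)
  rw [mulVec_sub]
  simp only [Pi.sub_apply, Pi.zero_apply]
  lia

theorem exists_isLeast_burningScripts (h : S.burningScripts.Nonempty) :
    ∃ y τ, IsLeast S.burningScripts y ∧
      S.IsStabilization (fun a => S.threshold a - 1 - (S.laplacian *ᵥ 1) a) τ ∧
      ∀ a, (S.laplacian *ᵥ y) a = S.threshold a - 1 - τ a := by
  obtain ⟨y₀, hy₀⟩ := h
  obtain ⟨τ, hτ⟩ := exists_isStabilization ⟨_, S.sub_one_mem_stabilizingScripts_iff.2 hy₀⟩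
  obtain ⟨z, hz, rfl⟩ := hτ.exists_isLeast
  refine ⟨z + 1, _, ⟨?_, fun y hy => ?_⟩, hτ, fun a => ?_⟩
  · rw [← sub_one_mem_stabilizingScripts_iff, add_sub_cancel_right]
    exact hz.1
  · exact le_sub_iff_add_le.1 (hz.2 (S.sub_one_mem_stabilizingScripts_iff.2 hy))
  · rw [mulVec_add]
    simp only [Pi.add_apply, Pi.sub_apply]
    ring

variable {S} in
theorem IsStabilization.neg_one_le {τ : A → ℤ}
    (h : S.IsStabilization (fun a => S.threshold a - 1 - (S.laplacian *ᵥ 1) a) τ) (a : A) :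
    -1 ≤ τ a := by
  refine le_of_reflTransGen_topples (by simp) (fun b => ?_) h.1 a
  have : 0 ≤ ∑ a, (S.send a b : ℤ) := by positivity
  simp only [laplacian_mulVec_apply, Pi.one_apply, mul_one]
  lia

end TopplingNetwork

namespace AbelianNetwork

variable {V : Type*} {G : Digraph V} {A Q : V → Type*} [DecidableEq V] [∀ v, DecidableEq (A v)]

section Executions

variable (N : AbelianNetwork G A Q)

omit [∀ v, DecidableEq (A v)] in
theorem next_comm (a b : Σ v, A v) : Function.Commute (N.next a) (N.next b) := by
  intro q
  obtain ⟨v, a⟩ := a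
  obtain ⟨u, b⟩ := b
  rcases eq_or_ne v u with rfl | h
  · simp [next, (N.proc v).t_comm a b]
  · simp only [next, Function.update_of_ne h, Function.update_of_ne h.symm]
    exact (Function.update_comm h _ _ _).symm

omit [DecidableEq V] in
theorem sent_congr {a : Σ v, A v} {q q' : ∀ v, Q v} (h : q a.1 = q' a.1) :
    N.sent a q = N.sent a q' := by
  funext b
  simp only [sent, h]

theorem sent_add_sent_next (a b : Σ v, A v) (q : ∀ v, Q v) :
    N.sent a q + N.sent b (N.next a q) = N.sent b q + N.sent a (N.next b q) := by
  obtain ⟨v, a⟩ := a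
  obtain ⟨u, b⟩ := b
  rcases eq_or_ne v u with rfl | h
  · funext c
    by_cases hc : G.Adj v c.1
    · have := ((N.proc v).o_perm [a, b] [b, a] (.swap _ _ _) ⟨c.1, hc⟩ (q v)).count_eq c.2
      simpa [outputWord, sent, next, hc] using this
    · simp [sent, hc]
  · have hb : N.sent ⟨u, b⟩ (N.next ⟨v, a⟩ q) = N.sent ⟨u, b⟩ q :=
      N.sent_congr (Function.update_of_ne h.symm _ _)
    have ha : N.sent ⟨v, a⟩ (N.next ⟨u, b⟩ q) = N.sent ⟨v, a⟩ q :=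
      N.sent_congr (Function.update_of_ne h _ _)
    rw [hb, ha, add_comm]

theorem sentByWord_perm {w w' : List (Σ v, A v)} (h : w.Perm w') :
    N.sentByWord w = N.sentByWord w' := by
  induction h with
  | nil => rfl
  | cons a _ ih =>
    funext q
    rw [sentByWord, sentByWord, ih]
  | swap a b l =>
    funext q
    simp only [sentByWord]
    rw [← add_assoc, ← add_assoc, sent_add_sent_next, (N.next_comm a b).eq]
  | trans _ _ ih₁ ih₂ => exact ih₁.trans ih₂

theorem sentByWord_append (w w' : List (Σ v, A v)) (q : ∀ v, Q v) :
    N.sentByWord (w ++ w') q = N.sentByWord w q + N.sentByWord w' (runWord N.next w q) := by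
  induction w generalizing q with
  | nil => exact (zero_add _).symm
  | cons a w ih => rw [List.cons_append, sentByWord, ih, sentByWord, runWord, add_assoc]

theorem exec_eq (w : List (Σ v, A v)) (x : (Σ v, A v) → ℤ) (q : ∀ v, Q v) :
    N.exec w (x, q) =
      (x - letterCount w + fun b => (N.sentByWord w q b : ℤ), runWord N.next w q) := by
  induction w generalizing x q with
  | nil => simp [exec, sentByWord, runWord, letterCount_nil, ← Pi.zero_def]
  | cons a w ih =>
    refine (ih _ _).trans (Prod.ext (funext fun b => ?_) rfl)
    simp only [letterCount_cons, sentByWord, Pi.add_apply, Pi.sub_apply, Pi.single_apply,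
      Nat.cast_add]
    ring

theorem sub_letterCount_le_exec (w : List (Σ v, A v)) (x : (Σ v, A v) → ℤ) (q : ∀ v, Q v) :
    x - letterCount w ≤ (N.exec w (x, q)).1 := by
  rw [exec_eq]
  exact le_add_of_nonneg_right fun b => Int.natCast_nonneg _

theorem exec_append (w w' : List (Σ v, A v)) (c : ((Σ v, A v) → ℤ) × (∀ v, Q v)) :
    N.exec (w ++ w') c = N.exec w' (N.exec w c) :=
  List.foldl_append

theorem exec_perm {w w' : List (Σ v, A v)} (h : w.Perm w') : N.exec w = N.exec w' := by
  funext ⟨x, q⟩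
  rw [exec_eq, exec_eq, N.sentByWord_perm h, runWord_perm N.next_comm h,
    letterCount_eq_iff_perm.2 h]

theorem exec_add (w : List (Σ v, A v)) (x y : (Σ v, A v) → ℤ) (q : ∀ v, Q v) :
    N.exec w (x + y, q) = (x + (N.exec w (y, q)).1, (N.exec w (y, q)).2) := by
  rw [exec_eq, exec_eq, add_sub_assoc, add_assoc]

variable {N}

theorem isLegal_append {w w' : List (Σ v, A v)} {c : ((Σ v, A v) → ℤ) × (∀ v, Q v)} :
    N.IsLegal (w ++ w') c ↔ N.IsLegal w c ∧ N.IsLegal w' (N.exec w c) := by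
  induction w generalizing c with
  | nil => exact (iff_of_eq (true_and _)).symm
  | cons a w ih => exact (and_congr_right fun _ => ih).trans and_assoc.symm

theorem IsLegal.mono {w : List (Σ v, A v)} {x y : (Σ v, A v) → ℤ} {q : ∀ v, Q v}
    (h : N.IsLegal w (x, q)) (hxy : x ≤ y) : N.IsLegal w (y, q) := by
  induction w generalizing x y q with
  | nil => trivial
  | cons a w ih =>
    exact ⟨h.1.trans (hxy a), ih h.2 fun b => add_le_add_left (sub_le_sub_right (hxy b) _) _⟩

theorem isLegal_letterCount (w : List (Σ v, A v)) (q : ∀ v, Q v) :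
    N.IsLegal w (letterCount w, q) := by
  induction w generalizing q with
  | nil => trivial
  | cons a w ih =>
    refine ⟨by simp [letterCount], (ih _).mono fun b => ?_⟩
    simp only [letterCount_cons, Pi.add_apply, Pi.single_apply]
    lia

theorem IsLegal.exec_nonneg_of_mem {w : List (Σ v, A v)} {c : ((Σ v, A v) → ℤ) × (∀ v, Q v)}
    (h : N.IsLegal w c) {a : Σ v, A v} (ha : a ∈ w ∨ 0 ≤ c.1 a) : 0 ≤ (N.exec w c).1 a := by
  induction w generalizing c with
  | nil => exact ha.resolve_left List.not_mem_nil
  | cons b w ih =>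
    refine ih h.2 ?_
    have hb := h.1
    rw [List.mem_cons, or_assoc, or_left_comm] at ha
    refine ha.imp_right fun ha => ?_
    dsimp only [step]
    split_ifs with hab
    · subst hab
      lia
    · have := ha.resolve_left hab
      lia

theorem IsLegal.exec_nonneg {w : List (Σ v, A v)} {c : ((Σ v, A v) → ℤ) × (∀ v, Q v)}
    (h : N.IsLegal w c) (hc : 0 ≤ c.1) : 0 ≤ (N.exec w c).1 :=
  fun a => h.exec_nonneg_of_mem (.inr (hc a))

theorem IsComplete.mem {w : List (Σ v, A v)} {c : ((Σ v, A v) → ℤ) × (∀ v, Q v)}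
    (h : N.IsComplete w c) {a : Σ v, A v} (ha : 1 ≤ c.1 a) : a ∈ w := by
  by_contra haw
  have hle := h a
  obtain ⟨x, q⟩ := c
  simp only [exec_eq, Pi.add_apply, Pi.sub_apply, letterCount, List.count_eq_zero_of_not_mem haw]
    at hle ha
  lia

theorem IsComplete.erase {w : List (Σ v, A v)} {c : ((Σ v, A v) → ℤ) × (∀ v, Q v)}
    (h : N.IsComplete w c) {a : Σ v, A v} (ha : a ∈ w) :
    N.IsComplete (w.erase a) (N.step c a) := by
  intro b
  have hb := h b
  rwa [N.exec_perm (List.perm_cons_erase ha)] at hb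

/-- The least action principle. -/
theorem IsLegal.subperm {w w' : List (Σ v, A v)} {c : ((Σ v, A v) → ℤ) × (∀ v, Q v)}
    (h : N.IsLegal w c) (h' : N.IsComplete w' c) : w.Subperm w' := by
  induction w generalizing w' c with
  | nil => exact List.nil_subperm
  | cons a w ih =>
    have ha : a ∈ w' := h'.mem h.1
    exact ((List.subperm_cons a).2 (ih h.2 (h'.erase ha))).trans
      (List.perm_cons_erase ha).symm.subperm

theorem IsComplete.haltsOn {w : List (Σ v, A v)} {x : (Σ v, A v) → ℤ} {q : ∀ v, Q v}
    (h : N.IsComplete w (x, q)) : N.HaltsOn x q := by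
  induction hn : w.length generalizing w x q with
  | zero =>
    obtain rfl := List.length_eq_zero_iff.1 hn
    exact ⟨[], trivial, h⟩
  | succ n ih =>
    by_cases hx : ∀ a, x a ≤ 0
    · exact ⟨[], trivial, hx⟩
    obtain ⟨a, ha⟩ : ∃ a, ¬ x a ≤ 0 := not_forall.1 hx
    have haw : a ∈ w := h.mem (not_le.1 ha)
    obtain ⟨w', hlegal, hcomplete⟩ := ih (h.erase haw) (by rw [List.length_erase_of_mem haw]; lia)
    exact ⟨a :: w', ⟨not_le.1 ha, hlegal⟩, hcomplete⟩

theorem HaltsOnAllInputs.haltsOn (hhalt : N.HaltsOnAllInputs) (x : (Σ v, A v) → ℤ)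
    (q : ∀ v, Q v) : N.HaltsOn x q := by
  obtain ⟨w, -, hw⟩ := hhalt (x ⊔ 0) q le_sup_right
  refine IsComplete.haltsOn (w := w) fun a => le_trans ?_ (hw a)
  rw [exec_eq, exec_eq]
  exact add_le_add_left (sub_le_sub_right (le_sup_left : x ≤ x ⊔ 0) _ a) _

end Executions

section GlobalAction

variable {N : AbelianNetwork G A Q}

theorem globalAct_eq_of_isComplete {w : List (Σ v, A v)} {x : (Σ v, A v) → ℤ} {q : ∀ v, Q v}
    (hlegal : N.IsLegal w (x, q)) (hcomplete : N.IsComplete w (x, q)) :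
    N.globalAct x q = (N.exec w (x, q)).2 := by
  have hx : N.HaltsOn x q := ⟨w, hlegal, hcomplete⟩
  obtain ⟨hlegal', hcomplete'⟩ := hx.choose_spec
  rw [globalAct, dif_pos hx,
    N.exec_perm ((hlegal'.subperm hcomplete).antisymm (hlegal.subperm hcomplete'))]

theorem globalAct_zero (q : ∀ v, Q v) : N.globalAct 0 q = q :=
  globalAct_eq_of_isComplete (w := []) trivial fun _ => le_rfl

theorem globalAct_exec (hhalt : N.HaltsOnAllInputs) {w : List (Σ v, A v)}
    {x : (Σ v, A v) → ℤ} {q : ∀ v, Q v} (h : N.IsLegal w (x, q)) :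
    N.globalAct (N.exec w (x, q)).1 (N.exec w (x, q)).2 = N.globalAct x q := by
  obtain ⟨w', hlegal, hcomplete⟩ := hhalt.haltsOn (N.exec w (x, q)).1 (N.exec w (x, q)).2
  rw [globalAct_eq_of_isComplete hlegal hcomplete,
    globalAct_eq_of_isComplete (w := w ++ w') (isLegal_append.2 ⟨h, hlegal⟩), exec_append]
  rwa [IsComplete, exec_append]

theorem globalAct_add (hhalt : N.HaltsOnAllInputs) {x y : (Σ v, A v) → ℤ} (hx : 0 ≤ x)
    (hy : 0 ≤ y) (q : ∀ v, Q v) :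
    N.globalAct (x + y) q = N.globalAct x (N.globalAct y q) := by
  obtain ⟨w, hlegal, hcomplete⟩ := hhalt y q hy
  have hfinal : (N.exec w (y, q)).1 = 0 := le_antisymm hcomplete (hlegal.exec_nonneg hy)
  rw [globalAct_eq_of_isComplete hlegal hcomplete,
    ← globalAct_exec hhalt (hlegal.mono (le_add_of_nonneg_left hx)), exec_add, hfinal, add_zero]

theorem globalAct_nsmul_of_isFixedPt (hhalt : N.HaltsOnAllInputs) {x : (Σ v, A v) → ℤ}
    (hx : 0 ≤ x) {q : ∀ v, Q v} (hq : N.globalAct x q = q) (n : ℕ) :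
    N.globalAct (n • x) q = q := by
  induction n with
  | zero => rw [zero_nsmul, globalAct_zero]
  | succ n ih => rw [succ_nsmul, globalAct_add hhalt (nsmul_nonneg hx n) hx, hq, ih]

theorem runWord_globalAct (hhalt : N.HaltsOnAllInputs) (w : List (Σ v, A v)) :
    runWord (fun a => N.globalAct (Pi.single a 1)) w = N.globalAct (letterCount w) := by
  funext q
  induction w generalizing q with
  | nil => exact (globalAct_zero q).symm
  | cons a w ih =>
    rw [runWord, ih, letterCount_cons, add_comm,
      globalAct_add hhalt (letterCount_nonneg w) (Pi.single_nonneg.2 zero_le_one)]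

theorem commute_globalAct_single (hhalt : N.HaltsOnAllInputs) (a b : Σ v, A v) :
    Function.Commute (N.globalAct (Pi.single a 1)) (N.globalAct (Pi.single b 1)) := by
  have hnonneg (c : Σ v, A v) : 0 ≤ (Pi.single c 1 : (Σ v, A v) → ℤ) :=
    Pi.single_nonneg.2 zero_le_one
  intro q
  rw [← globalAct_add hhalt (hnonneg a) (hnonneg b), add_comm,
    globalAct_add hhalt (hnonneg b) (hnonneg a)]

variable [Finite V] [∀ v, Finite (Q v)]

theorem exists_forall_globalAct_mem_recStates (hhalt : N.HaltsOnAllInputs) :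
    ∃ x, 0 ≤ x ∧ ∀ q, N.globalAct x q ∈ N.recStates := by
  obtain ⟨w, hw⟩ := exists_forall_runWord_mem_recurrentStates (commute_globalAct_single hhalt)
  exact ⟨letterCount w, letterCount_nonneg w, fun q => runWord_globalAct hhalt w ▸ hw q⟩

variable [∀ v, Finite (A v)]

omit [∀ v, Finite (Q v)] in
theorem mapsTo_globalAct_recStates (hhalt : N.HaltsOnAllInputs) {x : (Σ v, A v) → ℤ}
    (hx : 0 ≤ x) : Set.MapsTo (N.globalAct x) N.recStates N.recStates := by
  obtain ⟨w, rfl⟩ := exists_letterCount_eq hx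
  exact runWord_globalAct hhalt w ▸
    mapsTo_runWord_recurrentStates (commute_globalAct_single hhalt) w

theorem injOn_globalAct_recStates (hhalt : N.HaltsOnAllInputs) {x : (Σ v, A v) → ℤ}
    (hx : 0 ≤ x) : Set.InjOn (N.globalAct x) N.recStates := by
  obtain ⟨w, rfl⟩ := exists_letterCount_eq hx
  exact runWord_globalAct hhalt w ▸
    injOn_runWord_recurrentStates (commute_globalAct_single hhalt) w

theorem surjOn_globalAct_recStates (hhalt : N.HaltsOnAllInputs) {x : (Σ v, A v) → ℤ}
    (hx : 0 ≤ x) : Set.SurjOn (N.globalAct x) N.recStates N.recStates := by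
  obtain ⟨w, rfl⟩ := exists_letterCount_eq hx
  exact runWord_globalAct hhalt w ▸
    surjOn_runWord_recurrentStates (commute_globalAct_single hhalt) w

end GlobalAction

section LocallyRecurrent

variable (N : AbelianNetwork G A Q)

omit [∀ v, DecidableEq (A v)] in
theorem runWord_next_map (v : V) (w : List (A v)) (q : ∀ v, Q v) :
    runWord N.next (w.map (Sigma.mk v)) q =
      Function.update q v (runWord (N.proc v).t w (q v)) := by
  induction w generalizing q with
  | nil => simp [runWord]
  | cons a w ih => simp [List.map_cons, runWord, ih, next]

theorem sentByWord_replicate_congr (n : ℕ) (a : Σ v, A v) {q q' : ∀ v, Q v}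
    (h : q a.1 = q' a.1) :
    N.sentByWord (List.replicate n a) q = N.sentByWord (List.replicate n a) q' := by
  induction n generalizing q q' with
  | zero => rfl
  | succ n ih =>
    rw [List.replicate_succ, sentByWord, sentByWord, N.sent_congr h, ih]
    simp [next, h]

theorem single_mem_totalKernel_iff (a : Σ v, A v) (m : ℤ) :
    Pi.single a m ∈ N.totalKernel ↔ Pi.single a.2 m ∈ (N.proc a.1).kernel := by
  have hcurry : Pi.single a m ∈ N.totalKernel ↔
      ∀ u, (Pi.single a.1 (Pi.single a.2 m) : ∀ u, A u → ℤ) u ∈ (N.proc u).kernel := by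
    rw [← Sigma.curry_single (γ := fun _ _ => ℤ)]
    rfl
  rw [hcurry]
  refine ⟨fun h => by simpa using h a.1, fun h u => ?_⟩
  rcases eq_or_ne u a.1 with rfl | hu
  · rwa [Pi.single_eq_same]
  · rw [Pi.single_eq_of_ne hu]
    exact (N.proc u).zero_mem_kernel

section FiniteStates

variable [∀ v, Finite (Q v)]

theorem resetNumber_mem (a : Σ v, A v) :
    N.resetNumber a ∈ {n : ℕ | 1 ≤ n ∧ Pi.single a (n : ℤ) ∈ N.totalKernel} := by
  obtain ⟨n, hn, hid⟩ := exists_eqOn_runWord_replicate_id (N.proc a.1).t_comm a.2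
  exact Nat.sInf_mem ⟨n, hn, (N.single_mem_totalKernel_iff a n).2
    (((N.proc a.1).single_mem_kernel_iff a.2 n).2 hid)⟩

theorem resetNumber_pos (a : Σ v, A v) : 0 < (N.resetNumber a : ℤ) :=
  Int.natCast_pos.2 (N.resetNumber_mem a).1

variable {N} {q : ∀ v, Q v}

theorem IsLocallyRecurrent.runWord_replicate_resetNumber (h : N.IsLocallyRecurrent q)
    (a : Σ v, A v) : runWord N.next (List.replicate (N.resetNumber a) a) q = q := by
  have hid := ((N.proc a.1).single_mem_kernel_iff a.2 _).1
    ((N.single_mem_totalKernel_iff a _).1 (N.resetNumber_mem a).2)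
  have hmap := N.runWord_next_map a.1 (List.replicate (N.resetNumber a) a.2) q
  rwa [hid (h a.1), id, Function.update_eq_self, List.map_replicate] at hmap

theorem IsLocallyRecurrent.sentByWord_replicate_resetNumber (hirr : N.IsIrreducible)
    (h : N.IsLocallyRecurrent q) (a b : Σ v, A v) :
    N.sentByWord (List.replicate (N.resetNumber a) a) q b = N.resetProduction a b := by
  have hex : ∃ q, N.IsLocallyRecurrent q := ⟨q, h⟩
  rw [resetProduction, dif_pos hex]
  obtain ⟨w, hw⟩ := (hirr a.1).exists_runWord_eq (N.proc a.1).t_comm (hex.choose a.1) (h a.1)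
  have hcomm := congrFun (N.sentByWord_perm (List.perm_append_comm
    (l₁ := List.replicate (N.resetNumber a) a) (l₂ := w.map (Sigma.mk a.1)))) hex.choose
  rw [sentByWord_append, sentByWord_append, hex.choose_spec.runWord_replicate_resetNumber,
    add_comm] at hcomm
  rw [add_left_cancel hcomm]
  refine congrFun (N.sentByWord_replicate_congr _ a ?_) b
  rw [runWord_next_map, Function.update_self, hw]

variable [Finite V]

omit [∀ v, DecidableEq (A v)] in
theorem isLocallyRecurrent_of_mem_recurrentStates_next (hq : q ∈ recurrentStates N.next) :
    N.IsLocallyRecurrent q := by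
  intro v
  obtain ⟨w, hw⟩ := exists_forall_runWord_mem_recurrentStates (N.proc v).t_comm
  obtain ⟨w', hw'⟩ := exists_leftInvOn_runWord N.next_comm (w.map (Sigma.mk v))
  have hinv := (commute_runWord N.next_comm _ w' q).trans (hw' hq)
  rw [← hinv, runWord_next_map, Function.update_self]
  exact hw _

theorem isLocallyRecurrent_of_mem_recStates [∀ v, Finite (A v)] (hhalt : N.HaltsOnAllInputs)
    (hq : q ∈ N.recStates) : N.IsLocallyRecurrent q := by
  obtain ⟨u, hu⟩ := exists_forall_runWord_mem_recurrentStates N.next_comm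
  obtain ⟨q', -, rfl⟩ := surjOn_globalAct_recStates hhalt (letterCount_nonneg u) hq
  rw [← globalAct_exec hhalt (isLegal_letterCount u q'), exec_eq]
  obtain ⟨w, hlegal, hcomplete⟩ := hhalt.haltsOn _ (runWord N.next u q')
  rw [globalAct_eq_of_isComplete hlegal hcomplete, exec_eq]
  exact isLocallyRecurrent_of_mem_recurrentStates_next
    (mapsTo_runWord_recurrentStates N.next_comm w (hu q'))

end FiniteStates

end LocallyRecurrent

section SandpileLaplacian

open Matrix

variable [Fintype V] [∀ v, Fintype (A v)] [∀ v, Finite (Q v)] {N : AbelianNetwork G A Q}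

theorem IsLocallyRecurrent.exec_replicate_resetNumber (hirr : N.IsIrreducible) {q : ∀ v, Q v}
    (h : N.IsLocallyRecurrent q) (a : Σ v, A v) (x : (Σ v, A v) → ℤ) :
    N.exec (List.replicate (N.resetNumber a) a) (x, q) =
      (x - N.sandpilization.laplacian *ᵥ Pi.single a 1, q) := by
  rw [exec_eq, h.runWord_replicate_resetNumber, letterCount_replicate, mulVec_single_one]
  refine Prod.ext (funext fun b => ?_) rfl
  rcases eq_or_ne b a with rfl | hba
  · simp only [h.sentByWord_replicate_resetNumber hirr, TopplingNetwork.laplacian, sandpilization,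
      Pi.add_apply, Pi.sub_apply, Pi.single_eq_same, col_apply, Matrix.sub_apply,
      diagonal_apply_eq, of_apply]
    ring
  · simp [h.sentByWord_replicate_resetNumber hirr, TopplingNetwork.laplacian, sandpilization, hba]

theorem IsLocallyRecurrent.exec_of_letterCount_eq (hirr : N.IsIrreducible) {q : ∀ v, Q v}
    (h : N.IsLocallyRecurrent q) {y : (Σ v, A v) → ℤ} (hy : 0 ≤ y) {w : List (Σ v, A v)}
    (hw : letterCount w = fun a => N.resetNumber a * y a) (x : (Σ v, A v) → ℤ) :
    N.exec w (x, q) = (x - N.sandpilization.laplacian *ᵥ y, q) := by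
  obtain ⟨l, rfl⟩ := exists_letterCount_eq hy
  rw [← letterCount_flatMap_replicate, letterCount_eq_iff_perm] at hw
  rw [N.exec_perm hw]
  clear hw hy
  induction l generalizing x with
  | nil => simp [letterCount_nil, exec]
  | cons a l ih =>
    rw [List.flatMap_cons, exec_append, h.exec_replicate_resetNumber hirr, ih, letterCount_cons,
      mulVec_add, sub_sub]

/-- After first executing a word that makes every state locally recurrent, at bounded cost, a word
acts like topplings up to its remainders modulo the reset numbers. -/
theorem exists_forall_sub_exec_le (hirr : N.IsIrreducible) :
    ∃ c : ℤ, ∀ w x q b, x b - (N.exec w (x, q)).1 b ≤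
      (N.sandpilization.laplacian *ᵥ fun a => letterCount w a / N.resetNumber a) b + c := by
  obtain ⟨u, hu⟩ := exists_forall_runWord_mem_recurrentStates N.next_comm
  obtain ⟨c, hc⟩ := (Set.finite_range fun p : (Σ v, A v) × (∀ v, Q v) =>
    (N.resetNumber p.1 + N.sentByWord u p.2 p.1 : ℤ)).bddAbove
  refine ⟨c, fun w x q b => ?_⟩
  obtain ⟨l, d, hw, hl, hd⟩ := exists_perm_append_of_forall_pos N.resetNumber_pos w
  set y : (Σ v, A v) → ℤ := fun a => letterCount w a / N.resetNumber a
  have hy : 0 ≤ y := fun a =>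
    Int.ediv_nonneg (letterCount_nonneg w a) (N.resetNumber_pos a).le
  have hperm : (w ++ u).Perm (u ++ (l ++ d)) := List.perm_append_comm.trans (hw.append_left u)
  have hexec := congrFun (N.exec_perm hperm) (x, q)
  rw [exec_append, exec_append, exec_append, N.exec_eq u x q,
    (isLocallyRecurrent_of_mem_recurrentStates_next (hu q)).exec_of_letterCount_eq hirr hy hl]
    at hexec
  have hd_lt := hd b
  have hd_le := N.sub_letterCount_le_exec d
    (x - letterCount u + (fun b => (N.sentByWord u q b : ℤ)) - N.sandpilization.laplacian *ᵥ y)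
    (runWord N.next u q) b
  have hc' := hc ⟨(b, (N.exec w (x, q)).2), rfl⟩
  have hu_eq := congrFun (congrArg Prod.fst
    (N.exec_eq u (N.exec w (x, q)).1 (N.exec w (x, q)).2)) b
  rw [← hexec] at hd_le
  simp only [Pi.sub_apply, Pi.add_apply] at hd_le hu_eq
  rw [Prod.mk.eta] at hu_eq
  dsimp only at hc'
  lia

theorem exists_one_le_and_le_laplacian_mulVec (hirr : N.IsIrreducible)
    (hhalt : N.HaltsOnAllInputs) (x : (Σ v, A v) → ℤ) :
    ∃ y, 1 ≤ y ∧ x ≤ N.sandpilization.laplacian *ᵥ y := by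
  obtain ⟨c, hc⟩ := exists_forall_sub_exec_le hirr
  let z : (Σ v, A v) → ℤ := fun a => max (x a + c) (N.resetNumber a)
  let q : ∀ v, Q v := fun v => (hirr v).1.some
  obtain ⟨w, -, hw⟩ := hhalt z q fun a => (N.resetNumber_pos a).le.trans (le_max_right _ _)
  refine ⟨fun a => letterCount w a / N.resetNumber a, fun a => ?_, fun a => ?_⟩
  · have hle := (N.sub_letterCount_le_exec w z q a).trans (hw a)
    rw [Pi.one_apply, Int.le_ediv_iff_mul_le (N.resetNumber_pos a), one_mul]
    exact (le_max_right _ _).trans (sub_nonpos.1 hle)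
  · have hz : x a + c ≤ z a := le_max_left _ _
    have := hc w z q a
    have := hw a
    lia

end SandpileLaplacian

section Burning

open Matrix

variable [Fintype V] [∀ v, Fintype (A v)] [∀ v, Finite (Q v)] {N : AbelianNetwork G A Q}
  {y : (Σ v, A v) → ℤ}

theorem globalAct_laplacian_mulVec_of_mem_recStates (hirr : N.IsIrreducible)
    (hhalt : N.HaltsOnAllInputs) (hy : y ∈ N.sandpilization.burningScripts) {q : ∀ v, Q v}
    (hq : q ∈ N.recStates) : N.globalAct (N.sandpilization.laplacian *ᵥ y) q = q := by
  have hy₀ : 0 ≤ y := zero_le_one.trans hy.1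
  obtain ⟨w, hw⟩ := exists_letterCount_eq (x := fun a => N.resetNumber a * y a)
    fun a => mul_nonneg (N.resetNumber_pos a).le (hy₀ a)
  set β := N.sandpilization.laplacian *ᵥ y
  have hexec : N.exec w (β + letterCount w, q) = (letterCount w, q) := by
    rw [(isLocallyRecurrent_of_mem_recStates hhalt hq).exec_of_letterCount_eq hirr hy₀ hw,
      add_sub_cancel_left]
  have hlegal : N.IsLegal w (β + letterCount w, q) :=
    (isLegal_letterCount w q).mono (le_add_of_nonneg_left hy.2)
  have hact : N.globalAct (letterCount w) (N.globalAct β q) = N.globalAct (letterCount w) q := by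
    rw [← globalAct_add hhalt (letterCount_nonneg w) hy.2, add_comm, ← globalAct_exec hhalt hlegal,
      hexec]
  exact injOn_globalAct_recStates hhalt (letterCount_nonneg w)
    (mapsTo_globalAct_recStates hhalt hy.2 hq) hq hact

/-- For large `n`, a complete execution of `(n L y - x).q` processes every letter, even though
counts may be negative at the start; so it ends with no letters at all. -/
theorem exists_globalAct_nsmul_laplacian_mulVec_eq (hirr : N.IsIrreducible)
    (hhalt : N.HaltsOnAllInputs) (hy : 1 ≤ y) {x : (Σ v, A v) → ℤ} (hx : 0 ≤ x) (q : ∀ v, Q v) :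
    ∃ (n : ℕ) (q' : ∀ v, Q v),
      N.globalAct (n • N.sandpilization.laplacian *ᵥ y) q = N.globalAct x q' := by
  obtain ⟨c, hc⟩ := exists_forall_sub_exec_le hirr
  obtain ⟨y₁, hy₁, hLy₁⟩ := exists_one_le_and_le_laplacian_mulVec hirr hhalt 1
  obtain ⟨y₂, -, hLy₂⟩ := exists_one_le_and_le_laplacian_mulVec hirr hhalt fun a => x a + c
  obtain ⟨m, hm⟩ := (Set.finite_range y₂).bddAbove
  obtain ⟨n, hn⟩ : ∃ n : ℕ, m < n := ⟨(m + 1).toNat, by lia⟩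
  obtain ⟨w, hlegal, hcomplete⟩ := hhalt.haltsOn (n • N.sandpilization.laplacian *ᵥ y - x) q
  set z : (Σ v, A v) → ℤ := fun a => letterCount w a / N.resetNumber a
  have hz : 0 ≤ z - (n • y - y₂) := by
    refine N.sandpilization.nonneg_of_laplacian_mulVec_nonneg hy₁ hLy₁ fun a => ?_
    have hca := hc w (n • N.sandpilization.laplacian *ᵥ y - x) q a
    have hwa := hcomplete a
    have hya := hLy₂ a
    simp only [mulVec_sub, mulVec_smul, Pi.sub_apply, Pi.zero_apply] at hca hya ⊢
    lia
  have hmem (a : Σ v, A v) : a ∈ w := by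
    by_contra ha
    have hza : z a = 0 := by simp [z, letterCount, List.count_eq_zero_of_not_mem ha]
    have hle : y₂ a ≤ m := hm ⟨a, rfl⟩
    have hna : n * 1 ≤ n * y a := mul_le_mul_of_nonneg_left (hy a) n.cast_nonneg
    have hza_nonneg : 0 ≤ z a - (n * y a - y₂ a) := by simpa using hz a
    lia
  have hfinal : (N.exec w (n • N.sandpilization.laplacian *ᵥ y - x, q)).1 = 0 :=
    le_antisymm hcomplete fun a => hlegal.exec_nonneg_of_mem (.inl (hmem a))
  refine ⟨n, (N.exec w (n • N.sandpilization.laplacian *ᵥ y - x, q)).2, ?_⟩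
  have hact := globalAct_exec hhalt (hlegal.mono (le_add_of_nonneg_left hx))
  rwa [exec_add, hfinal, add_zero, add_sub_cancel, eq_comm] at hact

theorem isBurningElement_laplacian_mulVec (hirr : N.IsIrreducible) (hhalt : N.HaltsOnAllInputs)
    (hy : y ∈ N.sandpilization.burningScripts) :
    N.IsBurningElement (N.sandpilization.laplacian *ᵥ y) := by
  refine ⟨hy.2, fun q => ⟨globalAct_laplacian_mulVec_of_mem_recStates hirr hhalt hy,
    fun hq => ?_⟩⟩
  obtain ⟨x, hx, hrec⟩ := exists_forall_globalAct_mem_recStates hhalt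
  obtain ⟨n, q', hq'⟩ := exists_globalAct_nsmul_laplacian_mulVec_eq hirr hhalt hy.1 hx q
  rw [globalAct_nsmul_of_isFixedPt hhalt hy.2 hq] at hq'
  exact hq' ▸ hrec q'

variable (N)

theorem laplacian_eq_map : N.laplacian = N.sandpilization.laplacian.map (Int.cast : ℤ → ℚ) := by
  ext b a
  have ha : (N.resetNumber a : ℚ) ≠ 0 := mod_cast (N.resetNumber_pos a).ne'
  rw [laplacian, resetMatrix, mul_diagonal]
  rcases eq_or_ne b a with rfl | hba
  · simp [productionMatrix, TopplingNetwork.laplacian, sandpilization, sub_mul, ha]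
  · simp [productionMatrix, TopplingNetwork.laplacian, sandpilization, ha, hba]

theorem laplacian_mulVec_intCast (y : (Σ v, A v) → ℤ) (a : Σ v, A v) :
    (N.laplacian *ᵥ fun b => (y b : ℚ)) a = ((N.sandpilization.laplacian *ᵥ y) a : ℤ) := by
  rw [laplacian_eq_map]
  exact (RingHom.map_mulVec (Int.castRingHom ℚ) _ _ a).symm

omit [∀ v, Finite (Q v)] in
theorem resetMatrix_mulVec_intCast (y : (Σ v, A v) → ℤ) (a : Σ v, A v) :
    (N.resetMatrix *ᵥ fun b => (y b : ℚ)) a = (N.resetNumber a * y a : ℤ) := by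
  rw [resetMatrix, mulVec_diagonal, Int.cast_mul, Int.cast_natCast]

theorem correspondingElement_resetNumber_mul (y : (Σ v, A v) → ℤ) (a : Σ v, A v) :
    N.correspondingElement (fun b => N.resetNumber b * y b) a =
      ((N.sandpilization.laplacian *ᵥ y) a : ℤ) := by
  rw [← laplacian_mulVec_intCast, laplacian, ← mulVec_mulVec, correspondingElement]
  simp only [← resetMatrix_mulVec_intCast]

variable {N}

theorem burningOdometers_eq_image (hrect : N.IsRectangular) :
    N.burningOdometers = (fun (y : (Σ v, A v) → ℤ) a => (N.resetNumber a : ℤ) * y a) ''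
      N.sandpilization.burningScripts := by
  have mem_iff (y : (Σ v, A v) → ℤ) : (fun a => N.resetNumber a * y a) ∈ N.burningOdometers ↔
      y ∈ N.sandpilization.burningScripts := by
    have hkernel : (fun a => N.resetNumber a * y a) ∈ N.totalKernel :=
      hrect ▸ fun a => dvd_mul_right _ _
    refine ⟨fun h => ⟨fun a => ?_, fun a => ?_⟩, fun h => ⟨fun a => ?_, fun a => ?_, hkernel⟩⟩
    · exact pos_of_mul_pos_right (h.2.1 a) (N.resetNumber_pos a).le
    · exact Int.cast_nonneg_iff.1 (N.correspondingElement_resetNumber_mul y a ▸ h.1 a)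
    · exact N.correspondingElement_resetNumber_mul y a ▸ Int.cast_nonneg_iff.2 (h.2 a)
    · exact mul_pos (N.resetNumber_pos a) (h.1 a)
  ext k
  constructor
  · intro hk
    obtain ⟨y, hy⟩ := Classical.skolem.1 (show k ∈ {k | ∀ a, _ ∣ k a} from hrect ▸ hk.2.2)
    obtain rfl := funext hy
    exact ⟨y, (mem_iff y).1 hk, rfl⟩
  · rintro ⟨y, hy, rfl⟩
    exact (mem_iff y).2 hy

theorem isLeast_burningOdometers (hrect : N.IsRectangular)
    (hy : IsLeast N.sandpilization.burningScripts y) :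
    IsLeast N.burningOdometers fun a => N.resetNumber a * y a := by
  rw [burningOdometers_eq_image hrect]
  refine Monotone.map_isLeast (fun y y' h a => ?_) hy
  exact mul_le_mul_of_nonneg_left (h a) (N.resetNumber_pos a).le

end Burning

end AbelianNetwork

theorem corollary5p6 {V : Type*} [Fintype V] [DecidableEq V] {G : Digraph V} {A Q : V → Type*}
    [∀ v, Fintype (A v)] [∀ v, DecidableEq (A v)] [∀ v, Finite (Q v)]
    (N : AbelianNetwork G A Q) (hirr : N.IsIrreducible) (hrect : N.IsRectangular)
    (hhalt : N.HaltsOnAllInputs) :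
    ∃ k y β : (Σ v, A v) → ℤ,
      -- `k = D y` is the pointwise smallest burning odometer
      IsLeast N.burningOdometers k ∧
      (∀ a, (k a : ℚ) = N.resetMatrix.mulVec (fun b => (y b : ℚ)) a) ∧
      -- `β` is the corresponding burning element, and `β = L y`
      (∀ a, (β a : ℚ) = N.correspondingElement k a) ∧
      N.IsBurningElement β ∧
      (∀ a, (β a : ℚ) = N.laplacian.mulVec (fun b => (y b : ℚ)) a) ∧
      -- `σ = r - 1 - L 1` is integral, it has a unique stabilization `σ°`, and `β = r - 1 - σ°`
      (∃ σ τ : (Σ v, A v) → ℤ,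
        (∀ a, (σ a : ℚ) = (N.resetNumber a : ℚ) - 1 - N.laplacian.mulVec 1 a) ∧
        (∀ τ', N.sandpilization.IsStabilization σ τ' ↔ τ' = τ) ∧
        ∀ a, β a = (N.resetNumber a : ℤ) - 1 - τ a) ∧
      ∀ a, 0 ≤ β a ∧ β a ≤ (N.resetNumber a : ℤ) := by
  obtain ⟨y₀, hy₀, hLy₀⟩ := AbelianNetwork.exists_one_le_and_le_laplacian_mulVec hirr hhalt 0
  obtain ⟨y, τ, hy, hτ, hyτ⟩ := N.sandpilization.exists_isLeast_burningScripts ⟨y₀, hy₀, hLy₀⟩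
  refine ⟨fun a => N.resetNumber a * y a, y, N.sandpilization.laplacian.mulVec y,
    AbelianNetwork.isLeast_burningOdometers hrect hy,
    fun a => (N.resetMatrix_mulVec_intCast y a).symm,
    fun a => (N.correspondingElement_resetNumber_mul y a).symm,
    AbelianNetwork.isBurningElement_laplacian_mulVec hirr hhalt hy.1,
    fun a => (N.laplacian_mulVec_intCast y a).symm,
    ⟨_, τ, fun a => ?_, fun τ' => ⟨hτ.unique, fun h => h ▸ hτ⟩, hyτ⟩,
    fun a => ⟨hy.1.2 a, ?_⟩⟩
  · have hL1 := N.laplacian_mulVec_intCast 1 a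
    simp only [Pi.one_apply, Int.cast_one] at hL1
    push_cast
    rw [← hL1]
    rfl
  · have hτ_ge : -1 ≤ τ a := hτ.neg_one_le a
    have hβ_eq : _ = (N.resetNumber a : ℤ) - 1 - τ a := hyτ a
    lia
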